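/- Let $L/K$ be a finite separable extension of fields with Galois closure $E$, let $G=\mathrm{Gal}(E/K)$, $G_L=\mathrm{Gal}(E/L)$, let $X=G/G_L$ be the left coset space, and let $\lambda:G\to\mathrm{Perm}(X)$, $\lambda(\sigma)(\tau G_L)=\sigma\tau G_L$. Let $N$ be a group and let $\alpha_1,\alpha_2:N\hookrightarrow\mathrm{Perm}(X)$ be injective homomorphisms whose images are regular (of the same size as $X$ and transitive on $X$) and normalized by $\lambda(G)$. For $i=1,2$ let $E[\alpha_i(N)]^G$ be the $K$-Hopf algebra of fixed points of the group algebra $E[\alpha_i(N)]$ under the simultaneous action of $G$ on $E$ as Galois automorphisms and on $\alpha_i(N)$ by $\sigma*\eta=\lambda(\sigma)\eta\lambda(\sigma)^{-1}$. Let $\mathrm{Hol}(N)$ be the normalizer in $\mathrm{Perm}(N)$ of the left regular image of $N$; it equals $\rho(N)\rtimes\mathrm{Aut}(N)$, where $\rho(n)(x)=xn^{-1}$. Let $\beta_i:G\hookrightarrow\mathrm{Hol}(N)$ be the embedding corresponding to $\alpha_i$ under Byott's translation, that is, $\beta_i(\sigma)=a_i^{-1}\circ\lambda(\sigma)\circ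 a_i$, where $a_i:N\to X$ is the bijection $a_i(\eta)=\alpha_i(\eta)(G_L)$, and let $\overline{\beta_i}:G\to\mathrm{Aut}(N)$ be the composition of $\beta_i$ with the projection of $\rho(N)\rtimes\mathrm{Aut}(N)$ onto $\mathrm{Aut}(N)$. Then: (1) $E[\alpha_1(N)]^G\cong E[\alpha_2(N)]^G$ as $K$-Hopf algebras if and only if there exists $\mu\in\mathrm{Aut}(N)$ such that $\overline{\beta_2}(g)=\mu\,\overline{\beta_1}(g)\,\mu^{-1}$ for all $g\in G$. (2) If $\mathrm{Aut}(N)$ is abelian (in particular, if $N$ is cyclic), then $E[\alpha_1(N)]^G\cong E[\alpha_2(N)]^G$ as $K$-Hopf algebras if and only if $\overline{\beta_1}(g)=\overline{\beta_2}(g)$ for all $g\in G$. -/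

import Mathlib

noncomputable section

open scoped TensorProduct

namespace HopfGalois

section Descent

universe u

variable {K E : Type*} {A : Type u} [Field K] [Field E] [Algebra K E] [Ring A] [HopfAlgebra E A]
  [Algebra K A] [IsScalarTower K E A]

/-- The canonical map `H ⊗[K] H → A ⊗[E] A`. -/
def tensorIncl (H : Subalgebra K A) : H ⊗[K] H →ₐ[K] A ⊗[E] A :=
  (Algebra.TensorProduct.mapOfCompatibleSMul E K K A A).comp
    (Algebra.TensorProduct.map H.val H.val)

@[simp] theorem tensorIncl_tmul (H : Subalgebra K A) (x y : H) :
    tensorIncl (E := E) H (x ⊗ₜ y) = (x : A) ⊗ₜ (y : A) := rfl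

/-- The canonical map `H ⊗[K] (H ⊗[K] H) → A ⊗[E] (A ⊗[E] A)`. -/
def tensorIncl₃ (H : Subalgebra K A) : H ⊗[K] (H ⊗[K] H) →ₐ[K] A ⊗[E] (A ⊗[E] A) :=
  (Algebra.TensorProduct.mapOfCompatibleSMul E K K A (A ⊗[E] A)).comp
    (Algebra.TensorProduct.map H.val (tensorIncl (E := E) H))

@[simp] theorem tensorIncl₃_tmul (H : Subalgebra K A) (x : H) (y : H ⊗[K] H) :
    tensorIncl₃ (E := E) H (x ⊗ₜ y) = (x : A) ⊗ₜ tensorIncl H y := rfl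

/-- A `K`-subalgebra `H` of an `E`-Hopf algebra `A` to which the Hopf algebra structure of `A`
restricts: `K`-linearly independent elements of `H` are `E`-linearly independent in `A`, and
`Δ`, `ε` and `S` restrict to `H`. -/
structure IsHopfForm (E : Type*) [Field E] [Algebra K E] [HopfAlgebra E A]
    [IsScalarTower K E A] (H : Subalgebra K A) : Prop where
  linInd : ∀ (ι : Type u) (v : ι → H), LinearIndependent K v →
    LinearIndependent E (fun i => (v i : A))
  comul_mem : ∀ h ∈ H, Coalgebra.comul (R := E) h ∈ (tensorIncl (E := E) H).range
  counit_mem : ∀ h ∈ H, Coalgebra.counit (R := E) h ∈ (Algebra.ofId K E).range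
  antipode_mem : ∀ h ∈ H, HopfAlgebra.antipode E h ∈ H

variable {H : Subalgebra K A}

theorem injective_of_basis {ι U V : Type*} [AddCommGroup U] [Module K U] [AddCommGroup V]
    [Module K V] [Module E V] [IsScalarTower K E V] (b : Module.Basis ι K U) (f : U →ₗ[K] V)
    (h : LinearIndependent E (fun i => f (b i))) : Function.Injective f := by
  have h' : LinearIndependent K (fun i => f (b i)) := by
    refine LinearIndependent.restrict_scalars (R := K) (K := E) ?_ h
    intro x y hxy
    simpa [Algebra.smul_def] using hxy
  rw [← LinearMap.ker_eq_bot, LinearMap.ker_eq_bot']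
  intro m hm
  have hb : f m = ∑ i ∈ (b.repr m).support, b.repr m i • f (b i) := by
    conv_lhs => rw [← b.linearCombination_repr m]
    simp [Finsupp.linearCombination_apply, Finsupp.sum, map_sum]
  rw [hm] at hb
  have := linearIndependent_iff'.1 h' _ _ hb.symm
  apply b.repr.injective
  ext i
  by_cases hi : i ∈ (b.repr m).support
  · simpa using this i hi
  · simpa using hi

theorem IsHopfForm.linInd₂ (hH : IsHopfForm E H) {ι : Type u} (b : Module.Basis ι K H) :
    LinearIndependent E (fun p : ι × ι => tensorIncl (E := E) H ((b.tensorProduct b) p)) := by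
  have := hH.linInd ι b b.linearIndependent
  simpa [Module.Basis.tensorProduct_apply'] using LinearIndependent.tmul_of_flat_right this this

theorem IsHopfForm.injective₂ (hH : IsHopfForm E H) :
    Function.Injective (tensorIncl (E := E) H) :=
  injective_of_basis (E := E) _ (tensorIncl (E := E) H).toLinearMap
    (hH.linInd₂ (Module.Basis.ofVectorSpace K H))

theorem IsHopfForm.injective₃ (hH : IsHopfForm E H) :
    Function.Injective (tensorIncl₃ (E := E) H) := by
  let b := Module.Basis.ofVectorSpace K H
  refine injective_of_basis (E := E) (b.tensorProduct (b.tensorProduct b))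
    (tensorIncl₃ (E := E) H).toLinearMap ?_
  have := LinearIndependent.tmul_of_flat_right (hH.linInd _ b b.linearIndependent) (hH.linInd₂ b)
  simpa [Module.Basis.tensorProduct_apply'] using this

/-- The comultiplication of a `K`-form, obtained by restriction. -/
def formComul (hH : IsHopfForm E H) : H →ₐ[K] H ⊗[K] H :=
  (AlgEquiv.ofInjective (tensorIncl (E := E) H) hH.injective₂).symm.toAlgHom.comp
    ((((Bialgebra.comulAlgHom E A).restrictScalars K).comp H.val).codRestrict _
      (fun h => hH.comul_mem h h.2))

theorem tensorIncl_formComul (hH : IsHopfForm E H) (h : H) :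
    tensorIncl (E := E) H (formComul hH h) = Coalgebra.comul (R := E) (h : A) :=
  congrArg Subtype.val ((AlgEquiv.ofInjective (tensorIncl (E := E) H) hH.injective₂).apply_symm_apply
    ⟨Coalgebra.comul (R := E) (h : A), hH.comul_mem h h.2⟩)

/-- The counit of a `K`-form, obtained by restriction. -/
def formCounit (hH : IsHopfForm E H) : H →ₐ[K] K :=
  (AlgEquiv.ofInjective (Algebra.ofId K E) (algebraMap K E).injective).symm.toAlgHom.comp
    ((((Bialgebra.counitAlgHom E A).restrictScalars K).comp H.val).codRestrict _
      (fun h => hH.counit_mem h h.2))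

theorem algebraMap_formCounit (hH : IsHopfForm E H) (h : H) :
    algebraMap K E (formCounit hH h) = Coalgebra.counit (R := E) (h : A) :=
  congrArg Subtype.val
    ((AlgEquiv.ofInjective (Algebra.ofId K E) (algebraMap K E).injective).apply_symm_apply
    ⟨Coalgebra.counit (R := E) (h : A), hH.counit_mem h h.2⟩)

/-- The antipode of a `K`-form, obtained by restriction. -/
def formAntipode (hH : IsHopfForm E H) : H →ₗ[K] H :=
  (((HopfAlgebra.antipode E (A := A)).restrictScalars K).comp
    H.val.toLinearMap).codRestrict (Subalgebra.toSubmodule H) (fun h => hH.antipode_mem h h.2)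

theorem coe_formAntipode (hH : IsHopfForm E H) (h : H) :
    (formAntipode hH h : A) = HopfAlgebra.antipode E (h : A) := rfl

/-- The Hopf algebra structure on a `K`-form, obtained by restricting `Δ`, `ε` and `S`. -/
@[reducible] def IsHopfForm.hopfAlgebra (hH : IsHopfForm E H) : HopfAlgebra K H :=
  letI : Bialgebra K H := Bialgebra.ofAlgHom (formComul hH) (formCounit hH)
    (by
      ext h
      apply hH.injective₃
      have h1 : ∀ (t : H ⊗[K] H) (y : H), tensorIncl₃ (E := E) H
          (Algebra.TensorProduct.assoc K K K H H H (t ⊗ₜ y)) =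
          TensorProduct.assoc E A A A (tensorIncl H t ⊗ₜ (y : A)) := by
        intro t y
        induction t with
        | zero => simp
        | tmul a b => simp
        | add a b ha hb => simp only [TensorProduct.add_tmul, map_add, ha, hb]
      have h2 : ∀ t : H ⊗[K] H, tensorIncl₃ (E := E) H
          (Algebra.TensorProduct.assoc K K K H H H
            (Algebra.TensorProduct.map (formComul hH) (.id K H) t)) =
          TensorProduct.assoc E A A A
            ((Coalgebra.comul (R := E) (A := A)).rTensor A (tensorIncl H t)) := by
        intro t
        induction t with
        | zero => simp
        | tmul a b => simp [h1, tensorIncl_formComul]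
        | add a b ha hb => simp only [map_add, ha, hb]
      have h3 : ∀ t : H ⊗[K] H, tensorIncl₃ (E := E) H
            (Algebra.TensorProduct.map (.id K H) (formComul hH) t) =
            ((Coalgebra.comul (R := E) (A := A)).lTensor A (tensorIncl H t)) := by
        intro t
        induction t with
        | zero => simp
        | tmul a b => simp [tensorIncl_formComul]
        | add a b ha hb => simp only [map_add, ha, hb]
      refine (h2 _).trans (Eq.trans ?_ (h3 _).symm)
      simp [tensorIncl_formComul])
    (by
      ext h
      apply (Algebra.TensorProduct.lid K H).injective
      apply Subtype.val_injective
      have h2 : ∀ t : H ⊗[K] H, ((Algebra.TensorProduct.lid K H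
            (Algebra.TensorProduct.map (formCounit hH) (.id K H) t) : H) : A) =
          TensorProduct.lid E A
            ((Coalgebra.counit (R := E) (A := A)).rTensor A (tensorIncl H t)) := by
        intro t
        induction t with
        | zero => simp
        | tmul a b => simp [← algebraMap_formCounit hH]
        | add a b ha hb => simp only [map_add, Subalgebra.coe_add, ha, hb]
      refine (h2 _).trans ?_
      simp [tensorIncl_formComul])
    (by
      ext h
      apply (Algebra.TensorProduct.rid K K H).injective
      apply Subtype.val_injective
      have h2 : ∀ t : H ⊗[K] H, ((Algebra.TensorProduct.rid K K H
            (Algebra.TensorProduct.map (.id K H) (formCounit hH) t) : H) : A) =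
          TensorProduct.rid E A
            ((Coalgebra.counit (R := E) (A := A)).lTensor A (tensorIncl H t)) := by
        intro t
        induction t with
        | zero => simp
        | tmul a b => simp [← algebraMap_formCounit hH]
        | add a b ha hb => simp only [map_add, Subalgebra.coe_add, ha, hb]
      refine (h2 _).trans ?_
      simp [tensorIncl_formComul])
  { antipode := formAntipode hH
    mul_antipode_rTensor_comul := by
      ext h
      have h2 : ∀ t : H ⊗[K] H, ((LinearMap.mul' K H ((formAntipode hH).rTensor H t) : H) : A) =
          LinearMap.mul' E A ((HopfAlgebra.antipode E (A := A)).rTensor A (tensorIncl H t)) := by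
        intro t
        induction t with
        | zero => simp
        | tmul a b => simp [coe_formAntipode]
        | add a b ha hb => simp only [map_add, Subalgebra.coe_add, ha, hb]
      refine (h2 (formComul hH h)).trans ?_
      rw [tensorIncl_formComul, HopfAlgebra.mul_antipode_rTensor_comul_apply,
        ← algebraMap_formCounit hH, ← IsScalarTower.algebraMap_apply]
      rfl
    mul_antipode_lTensor_comul := by
      ext h
      have h2 : ∀ t : H ⊗[K] H, ((LinearMap.mul' K H ((formAntipode hH).lTensor H t) : H) : A) =
          LinearMap.mul' E A ((HopfAlgebra.antipode E (A := A)).lTensor A (tensorIncl H t)) := by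
        intro t
        induction t with
        | zero => simp
        | tmul a b => simp [coe_formAntipode]
        | add a b ha hb => simp only [map_add, Subalgebra.coe_add, ha, hb]
      refine (h2 (formComul hH h)).trans ?_
      rw [tensorIncl_formComul, HopfAlgebra.mul_antipode_lTensor_comul_apply,
        ← algebraMap_formCounit hH, ← IsScalarTower.algebraMap_apply]
      rfl }

end Descent
section FixedPoints

variable {K E M : Type*} [Field K] [Field E] [Algebra K E] [Group M]

/-- The simultaneous action of `Gal(E/K)` on the group algebra `E[M]` of a group `M` on which
`Gal(E/K)` acts by automorphisms: `σ • ∑ aₘ m = ∑ σ(aₘ) (θ σ m)`. -/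
def galAction (θ : Gal(E/K) →* MulAut M) :
    Gal(E/K) →* (MonoidAlgebra E M ≃ₐ[K] MonoidAlgebra E M) where
  toFun σ := (MonoidAlgebra.mapAlgEquiv K M σ).trans (MonoidAlgebra.domCongr K E (θ σ))
  map_one' := by
    refine AlgEquiv.ext fun x => ?_
    induction x using MonoidAlgebra.induction_linear with
    | zero => simp
    | add x y hx hy => simp only [map_add, hx, hy]
    | single m r => simp
  map_mul' σ τ := by
    refine AlgEquiv.ext fun x => ?_
    induction x using MonoidAlgebra.induction_linear with
    | zero => simp
    | add x y hx hy => simp only [map_add, hx, hy]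
    | single m r => simp

theorem galAction_single (θ : Gal(E/K) →* MulAut M) (σ : Gal(E/K)) (m : M) (a : E) :
    galAction θ σ (MonoidAlgebra.single m a) = MonoidAlgebra.single (θ σ m) (σ a) := by
  simp [galAction]

/-- The fixed points `E[M]^G` of `G = Gal(E/K)` acting simultaneously on `E` and on `M`. -/
def fixedAlgebra (θ : Gal(E/K) →* MulAut M) : Subalgebra K (MonoidAlgebra E M) where
  carrier := {x | ∀ σ, galAction θ σ x = x}
  mul_mem' hx hy σ := by rw [map_mul, hx σ, hy σ]
  add_mem' hx hy σ := by rw [map_add, hx σ, hy σ]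
  algebraMap_mem' r σ := AlgEquiv.commutes _ r

theorem galAction_smul (θ : Gal(E/K) →* MulAut M) (σ : Gal(E/K)) (a : E) (x : MonoidAlgebra E M) :
    galAction θ σ (a • x) = σ a • galAction θ σ x := by
  induction x using MonoidAlgebra.induction_linear with
  | zero => simp
  | add x y hx hy => simp only [smul_add, map_add, hx, hy]
  | single m r => simp [galAction_single]

theorem counit_galAction (θ : Gal(E/K) →* MulAut M) (σ : Gal(E/K)) (x : MonoidAlgebra E M) :
    Coalgebra.counit (R := E) (galAction θ σ x) = σ (Coalgebra.counit (R := E) x) := by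
  induction x using MonoidAlgebra.induction_linear with
  | zero => simp
  | add x y hx hy => simp only [map_add, hx, hy]
  | single m r => simp [galAction_single]

theorem antipode_galAction (θ : Gal(E/K) →* MulAut M) (σ : Gal(E/K)) (x : MonoidAlgebra E M) :
    HopfAlgebra.antipode E (galAction θ σ x) = galAction θ σ (HopfAlgebra.antipode E x) := by
  induction x using MonoidAlgebra.induction_linear with
  | zero => simp
  | add x y hx hy => simp only [map_add, hx, hy]
  | single m r => simp [galAction_single]

variable [FiniteDimensional K E]

/-- The trace `∑ σ, σ • x` as an element of `E[M]^G`. -/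
def orbitSum (θ : Gal(E/K) →* MulAut M) (x : MonoidAlgebra E M) : fixedAlgebra θ :=
  ⟨∑ σ, galAction θ σ x, fun τ => by
    rw [map_sum]
    exact Fintype.sum_equiv (Equiv.mulLeft τ) _ _ (fun σ => by simp)⟩

theorem coe_orbitSum (θ : Gal(E/K) →* MulAut M) (x : MonoidAlgebra E M) :
    (orbitSum θ x : MonoidAlgebra E M) = ∑ σ, galAction θ σ x := rfl

variable [IsGalois K E]

open Classical in
theorem exists_dual_families : ∃ b d : Gal(E/K) → E, ∀ σ τ : Gal(E/K),
    ∑ i, σ (b i) * τ (d i) = if σ = τ then 1 else 0 := by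
  have hc : Fintype.card (Fin (Module.finrank K E)) = Fintype.card Gal(E/K) := by
    rw [Fintype.card_fin, ← Nat.card_eq_fintype_card, IsGalois.card_aut_eq_finrank]
  let b : Module.Basis Gal(E/K) K E := (Module.finBasis K E).reindex (Fintype.equivOfCardEq hc)
  let B : Matrix Gal(E/K) Gal(E/K) E := fun σ i => σ (b i)
  let D : Matrix Gal(E/K) Gal(E/K) E := fun i τ => τ (b.traceDual i)
  have hDB : D * B = 1 := by
    ext i j
    have h2 := trace_eq_sum_automorphisms (K := K) (b.traceDual i * b j)
    rw [b.trace_traceDual_mul i j] at h2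
    simp only [map_mul] at h2
    rw [Matrix.mul_apply, Matrix.one_apply]
    refine h2.symm.trans ?_
    by_cases hij : i = j
    · simp [hij]
    · simp [hij, Ne.symm hij]
  have hBD : B * D = 1 := mul_eq_one_comm.1 hDB
  refine ⟨b, b.traceDual, fun σ τ => ?_⟩
  have := congrFun (congrFun hBD σ) τ
  rwa [Matrix.mul_apply, Matrix.one_apply] at this

theorem isHopfForm_fixedAlgebra (θ : Gal(E/K) →* MulAut M) :
    IsHopfForm E (fixedAlgebra θ) where
  linInd ι v hv := by
    rw [linearIndependent_iff'] at hv ⊢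
    intro s x hx i hi
    have key : ∀ e : E, Algebra.trace K E (x i * e) = 0 := by
      intro e
      refine hv s (fun i => Algebra.trace K E (x i * e)) ?_ i hi
      apply Subtype.val_injective
      rw [AddSubmonoidClass.coe_finsetSum]
      calc ∑ i ∈ s, ((Algebra.trace K E (x i * e) • v i : fixedAlgebra θ) : MonoidAlgebra E M)
          = ∑ σ : Gal(E/K), galAction θ σ (e • ∑ i ∈ s, x i • (v i : MonoidAlgebra E M)) := by
            simp only [Finset.smul_sum, map_sum, smul_smul, galAction_smul]
            rw [Finset.sum_comm]
            refine Finset.sum_congr rfl fun i _ => ?_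
            rw [Subalgebra.coe_smul, ← algebraMap_smul E, trace_eq_sum_automorphisms,
              Finset.sum_smul]
            refine Finset.sum_congr rfl fun σ _ => ?_
            rw [(v i).2 σ, mul_comm]
        _ = _ := by simp [hx]
    exact (traceForm_nondegenerate K E).1 (x i) key
  comul_mem h hh := by
    classical
    obtain ⟨b, d, hbd⟩ := exists_dual_families (K := K) (E := E)
    have h1 : ∀ (e : E) (m : M), Coalgebra.comul (R := E)
        (orbitSum θ (MonoidAlgebra.single m e) : MonoidAlgebra E M) ∈
        (tensorIncl (E := E) (fixedAlgebra θ)).range := by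
      intro e m
      refine ⟨∑ i, orbitSum θ (MonoidAlgebra.single m (e * b i)) ⊗ₜ
        orbitSum θ (MonoidAlgebra.single m (d i)), ?_⟩
      simp only [map_sum]
      have h3 : ∀ i, tensorIncl (E := E) (fixedAlgebra θ)
          (orbitSum θ (MonoidAlgebra.single m (e * b i)) ⊗ₜ
            orbitSum θ (MonoidAlgebra.single m (d i))) =
          ∑ σ, ∑ τ, (σ e * (σ (b i) * τ (d i))) •
            ((MonoidAlgebra.single (θ σ m) (1 : E)) ⊗ₜ[E]
              (MonoidAlgebra.single (θ τ m) (1 : E))) := by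
        intro i
        change (orbitSum θ (MonoidAlgebra.single m (e * b i)) : MonoidAlgebra E M) ⊗ₜ[E]
          (orbitSum θ (MonoidAlgebra.single m (d i)) : MonoidAlgebra E M) = _
        rw [coe_orbitSum, coe_orbitSum, TensorProduct.sum_tmul]
        refine Finset.sum_congr rfl fun σ _ => ?_
        rw [TensorProduct.tmul_sum]
        refine Finset.sum_congr rfl fun τ _ => ?_
        rw [galAction_single, galAction_single, ← mul_assoc, ← TensorProduct.smul_tmul_smul]
        simp
      change ∑ i, tensorIncl (E := E) (fixedAlgebra θ) _ = _
      simp only [h3]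
      rw [Finset.sum_comm]
      rw [coe_orbitSum, map_sum]
      refine Finset.sum_congr rfl fun σ _ => ?_
      rw [Finset.sum_comm]
      simp only [← Finset.sum_smul, ← Finset.mul_sum, hbd]
      have h5 : ∀ (n : M) (a : E), MonoidAlgebra.single n a = a • MonoidAlgebra.single n (1 : E) :=
        fun n a => by simp
      simp only [mul_ite, mul_one, mul_zero, ite_smul, zero_smul, Finset.sum_ite_eq,
        Finset.mem_univ, if_true, galAction_single, MonoidAlgebra.comul_single,
        CommSemiring.comul_apply, TensorProduct.map_tmul, MonoidAlgebra.lsingle_apply]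
      rw [h5 _ (σ e)]
      exact (TensorProduct.tmul_smul _ _ _).symm
    obtain ⟨c, hc⟩ := Algebra.trace_surjective K E 1
    have h2 : h = ∑ m ∈ h.coeff.support,
        (orbitSum θ (MonoidAlgebra.single m (c * h.coeff m)) : MonoidAlgebra E M) := by
      have h3 : ∑ σ, galAction θ σ (c • h) = h := by
        simp only [galAction_smul, hh _]
        rw [← Finset.sum_smul, ← trace_eq_sum_automorphisms, hc]
        simp
      have h4 : c • h = ∑ m ∈ h.coeff.support, MonoidAlgebra.single m (c * h.coeff m) := by
        conv_lhs => rw [← MonoidAlgebra.sum_coeff_single h]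
        simp [Finsupp.sum, Finset.smul_sum]
      conv_lhs => rw [← h3, h4]
      simp only [map_sum, coe_orbitSum]
      rw [Finset.sum_comm]
    rw [h2, map_sum]
    exact Subalgebra.sum_mem _ fun m _ => h1 _ _
  counit_mem h hh := by
    have : ∀ σ : Gal(E/K), σ (Coalgebra.counit (R := E) h) = Coalgebra.counit (R := E) h :=
      fun σ => by rw [← counit_galAction θ, hh σ]
    exact (IsGalois.mem_range_algebraMap_iff_fixed _).2 this
  antipode_mem h hh σ := by rw [← antipode_galAction, hh σ]

/-- The `K`-Hopf algebra structure on `E[M]^G`, restricted from the `E`-Hopf algebra `E[M]`. -/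
instance instHopfAlgebraFixedAlgebra (θ : Gal(E/K) →* MulAut M) : HopfAlgebra K (fixedAlgebra θ) :=
  (isHopfForm_fixedAlgebra θ).hopfAlgebra

/-- The comultiplication of `E[M]^G` is the restriction of that of `E[M]`. -/
theorem tensorIncl_comul (θ : Gal(E/K) →* MulAut M) (h : fixedAlgebra θ) :
    tensorIncl (E := E) (fixedAlgebra θ) (Coalgebra.comul (R := K) h) =
      Coalgebra.comul (R := E) (h : MonoidAlgebra E M) :=
  tensorIncl_formComul (isHopfForm_fixedAlgebra θ) h

/-- The counit of `E[M]^G` is the restriction of that of `E[M]`. -/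
theorem algebraMap_counit (θ : Gal(E/K) →* MulAut M) (h : fixedAlgebra θ) :
    algebraMap K E (Coalgebra.counit (R := K) h) =
      Coalgebra.counit (R := E) (h : MonoidAlgebra E M) :=
  algebraMap_formCounit (isHopfForm_fixedAlgebra θ) h

end FixedPoints

section Holomorph

variable (N : Type*) [Group N]

/-- The left regular embedding `λ : N → Perm N`, `λ(n)(x) = n x`. -/
def leftRegular : N →* Equiv.Perm N := MulAction.toPermHom N N

/-- The right regular embedding `ρ : N → Perm N`, `ρ(n)(x) = x n⁻¹`. -/
def rightRegular : N →* Equiv.Perm N where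
  toFun n := Equiv.mulRight n⁻¹
  map_one' := by ext; simp
  map_mul' a b := by ext; simp [mul_assoc]

/-- The holomorph of `N`: the normalizer of `λ(N)` in `Perm N`. -/
def Hol : Subgroup (Equiv.Perm N) :=
  Subgroup.normalizer ((leftRegular N).range : Set (Equiv.Perm N))

variable {N}

@[simp] theorem leftRegular_apply (n x : N) : leftRegular N n x = n * x := rfl

@[simp] theorem rightRegular_apply (n x : N) : rightRegular N n x = x * n⁻¹ := rfl

theorem mem_Hol_of (f : Equiv.Perm N) (φ : MulAut N)
    (h : ∀ n x, f (n * x) = φ n * f x) : f ∈ Hol N := by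
  refine Subgroup.mem_normalizer_iff.2 fun g => ⟨?_, ?_⟩
  · rintro ⟨n, rfl⟩
    refine ⟨φ n, Equiv.ext fun x => ?_⟩
    simp [h]
  · rintro ⟨n, hn⟩
    refine ⟨φ.symm n, Equiv.ext fun x => f.injective ?_⟩
    have := congrArg (fun p => p (f x)) hn
    simp only [leftRegular_apply, Equiv.Perm.mul_apply, Equiv.Perm.inv_def,
      Equiv.symm_apply_apply] at this
    rw [leftRegular_apply, h, ← this]
    simp

theorem apply_mul_of_mem_Hol {f : Equiv.Perm N} (hf : f ∈ Hol N) (n x : N) :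
    f (n * x) = f n * (f 1)⁻¹ * f x := by
  obtain ⟨m, hm⟩ := (Subgroup.mem_normalizer_iff.1 hf (leftRegular N n)).1 ⟨n, rfl⟩
  have key : ∀ y, m * f y = f (n * y) := fun y => by
    have := congrArg (fun p => p (f y)) hm
    simpa using this
  have h1 := key 1
  rw [mul_one] at h1
  rw [← key x, ← h1]
  group

/-- The automorphism `x ↦ f(x) f(1)⁻¹` attached to an element `f` of the holomorph. -/
def holAut (f : Hol N) : MulAut N where
  toEquiv := f.1.trans (Equiv.mulRight (f.1 1)⁻¹)
  map_mul' x y := by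
    simp [apply_mul_of_mem_Hol f.2 x y, mul_assoc]

@[simp] theorem holAut_apply (f : Hol N) (x : N) : holAut f x = f.1 x * (f.1 1)⁻¹ := rfl

theorem toPerm_apply (φ : MulAut N) (x : N) : MulAut.toPerm N φ x = φ x := rfl

variable (N)

/-- The decomposition `Hol N = ρ(N) ⋊ Aut N`, in which `(n, φ)` is the permutation `ρ(n) ∘ φ`. -/
def holEquiv : N ⋊[MonoidHom.id (MulAut N)] MulAut N ≃* Hol N where
  toFun p := ⟨rightRegular N p.left * MulAut.toPerm N p.right,
    mem_Hol_of _ p.right fun n x => by simp [toPerm_apply, mul_assoc]⟩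
  invFun f := ⟨(f.1 1)⁻¹, holAut f⟩
  left_inv p := by
    ext <;> simp [toPerm_apply]
  right_inv f := by
    apply Subtype.ext
    apply Equiv.ext
    intro x
    change f.1 x * (f.1 1)⁻¹ * ((f.1 1)⁻¹)⁻¹ = f.1 x
    simp
  map_mul' p q := by
    apply Subtype.ext
    apply Equiv.ext
    intro x
    simp [toPerm_apply, mul_assoc]

/-- The projection of `Hol N = ρ(N) ⋊ Aut N` onto the component `Aut N`. -/
def holProj : Hol N →* MulAut N :=
  SemidirectProduct.rightHom.comp (holEquiv N).symm.toMonoidHom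

end Holomorph

section GreitherPareigis

variable {K E : Type*} [Field K] [Field E] [Algebra K E]

/-- The left coset space `X = G/G_L`, where `G = Gal(E/K)` and `G_L = Gal(E/L)`. -/
abbrev CosetSpace (L : IntermediateField K E) : Type _ := Gal(E/K) ⧸ L.fixingSubgroup

/-- The homomorphism `λ : G → Perm X`, `λ(σ)(τ G_L) = σ τ G_L`. -/
def lam (L : IntermediateField K E) : Gal(E/K) →* Equiv.Perm (CosetSpace L) :=
  MulAction.toPermHom Gal(E/K) (CosetSpace L)

/-- A subgroup of `Perm X` is regular if it has the same size as `X` and is transitive on `X`. -/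
def IsRegularSubgroup {X : Type*} (M : Subgroup (Equiv.Perm X)) : Prop :=
  Nat.card M = Nat.card X ∧ ∀ x y : X, ∃ p ∈ M, p x = y

/-- The embeddings `α : N → Perm X` whose image is regular and normalized by `λ(G)`. -/
structure RegularEmbedding (L : IntermediateField K E) (N : Type*) [Group N] where
  toHom : N →* Equiv.Perm (CosetSpace L)
  injective : Function.Injective toHom
  regular : IsRegularSubgroup toHom.range
  normalized : (lam L).range ≤
    Subgroup.normalizer (toHom.range : Set (Equiv.Perm (CosetSpace L)))

/-- The embeddings `β : G → Hol N` such that `β(G_L)` is the stabilizer of `e_N` in `β(G)`. -/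
structure HolEmbedding (L : IntermediateField K E) (N : Type*) [Group N] where
  toHom : Gal(E/K) →* Hol N
  injective : Function.Injective toHom
  stabilizer : ∀ b : Hol N,
    b ∈ L.fixingSubgroup.map toHom ↔ b ∈ toHom.range ∧ (b : Equiv.Perm N) 1 = 1

variable {L : IntermediateField K E} {N : Type*} [Group N]

namespace RegularEmbedding

/-- The action `σ ∗ η = λ(σ) η λ(σ)⁻¹` of `G` on `α(N)`. -/
def conjAction (α : RegularEmbedding L N) : Gal(E/K) →* MulAut α.toHom.range :=
  α.toHom.range.normalizerMonoidHom.comp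
    ((lam L).codRestrict _ fun σ => α.normalized ⟨σ, rfl⟩)

theorem coe_conjAction (α : RegularEmbedding L N) (σ : Gal(E/K)) (η : α.toHom.range) :
    (α.conjAction σ η : Equiv.Perm (CosetSpace L)) = lam L σ * η * (lam L σ)⁻¹ := rfl

/-- The Hopf algebra `E[α(N)]^G`. -/
abbrev hopfAlgebra (α : RegularEmbedding L N) :
    Subalgebra K (MonoidAlgebra E α.toHom.range) :=
  fixedAlgebra α.conjAction

theorem lam_injective [IsNormalClosure K L E] : Function.Injective (lam L) := by
  have : Normal K E := IsNormalClosure.normal (K := L)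
  rw [injective_iff_map_eq_one]
  intro σ hσ
  have h1 : ∀ (τ : Gal(E/K)) (x : L), σ (τ x) = τ x := by
    intro τ x
    have h2 : ((σ * τ : Gal(E/K)) : CosetSpace L) = (τ : CosetSpace L) :=
      congrArg (fun p => p (τ : CosetSpace L)) hσ
    have h3 := (IntermediateField.mem_fixingSubgroup_iff L _).1
      (QuotientGroup.eq.1 h2.symm) x x.2
    have := congrArg τ h3
    simpa using this
  have h4 : (⊤ : IntermediateField K E) ≤
      IntermediateField.fixedField (Subgroup.zpowers σ) := by
    rw [← IsNormalClosure.adjoin_rootSet (F := K) (K := L) (L := E)]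
    refine iSup_le fun x => IntermediateField.adjoin_le_iff.2 fun y hy => ?_
    have hy' : Polynomial.aeval y (minpoly K (x : E)) = 0 := by
      have := (Polynomial.mem_rootSet.1 hy).2
      rwa [← minpoly.algebraMap_eq (algebraMap L E).injective] at this
    obtain ⟨τ, hτ⟩ := minpoly.exists_algEquiv_of_root (Algebra.IsAlgebraic.isAlgebraic (x : E)) hy'
    rintro ⟨g, k, rfl⟩
    have h5 : σ ∈ MulAction.stabilizer Gal(E/K) y := by
      have h6 : y = τ⁻¹ (x : E) := by
        rw [← hτ]
        exact (τ.symm_apply_apply y).symm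
      rw [h6]
      exact h1 τ⁻¹ x
    exact (MulAction.stabilizer Gal(E/K) y).zpow_mem h5 k
  ext y
  exact h4 (IntermediateField.mem_top : y ∈ ⊤) ⟨σ, Subgroup.mem_zpowers σ⟩

variable [FiniteDimensional K E]

theorem orbitMap_bijective (α : RegularEmbedding L N) :
    Function.Bijective fun η : N => α.toHom η ((1 : Gal(E/K)) : CosetSpace L) := by
  have hcard : Nat.card N = Nat.card (CosetSpace L) := by
    rw [← α.regular.1]
    exact Nat.card_congr (MonoidHom.ofInjective α.injective).toEquiv
  have : Finite N := (Nat.card_pos_iff.1 (hcard ▸ Nat.card_pos)).2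
  have : Finite (CosetSpace L) := inferInstance
  refine (Nat.bijective_iff_surjective_and_card _).2 ⟨fun x => ?_, hcard⟩
  obtain ⟨_, ⟨η, rfl⟩, hη⟩ := α.regular.2 ((1 : Gal(E/K)) : CosetSpace L) x
  exact ⟨η, hη⟩

/-- The bijection `a : N → X`, `a(η) = α(η)(e G_L)`, attached to a regular embedding `α`. -/
def orbitEquiv (α : RegularEmbedding L N) : N ≃ CosetSpace L :=
  Equiv.ofBijective _ α.orbitMap_bijective

theorem orbitEquiv_apply (α : RegularEmbedding L N) (η : N) :
    α.orbitEquiv η = α.toHom η ((1 : Gal(E/K)) : CosetSpace L) := rfl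

theorem orbitEquiv_mul (α : RegularEmbedding L N) (η x : N) :
    α.orbitEquiv (η * x) = α.toHom η (α.orbitEquiv x) := by
  simp [orbitEquiv_apply]

theorem translate_mem_Hol (α : RegularEmbedding L N) (σ : Gal(E/K)) :
    α.orbitEquiv.symm.permCongr (lam L σ) ∈ Hol N := by
  let i : N ≃* α.toHom.range := MonoidHom.ofInjective α.injective
  let φ : MulAut N := (i.trans (α.conjAction σ)).trans i.symm
  have hφ : ∀ n, α.toHom (φ n) = lam L σ * α.toHom n * (lam L σ)⁻¹ := by
    intro n
    have : i (φ n) = α.conjAction σ (i n) := by simp [φ]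
    have := congrArg Subtype.val this
    exact this
  refine mem_Hol_of _ φ fun n x => α.orbitEquiv.injective ?_
  simp [Equiv.permCongr_apply, orbitEquiv_mul, hφ]

/-- Byott's translation as a homomorphism: `β(σ) = a⁻¹ ∘ λ(σ) ∘ a`. -/
def translateHom (α : RegularEmbedding L N) : Gal(E/K) →* Hol N :=
  (α.orbitEquiv.symm.permCongrHom.toMonoidHom.comp (lam L)).codRestrict (Hol N)
    α.translate_mem_Hol

theorem orbitEquiv_translateHom (α : RegularEmbedding L N) (σ : Gal(E/K)) (η : N) :
    α.orbitEquiv ((α.translateHom σ : Equiv.Perm N) η) = lam L σ (α.orbitEquiv η) :=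
  α.orbitEquiv.apply_symm_apply _

theorem translateHom_apply_one (α : RegularEmbedding L N) (σ : Gal(E/K)) :
    (α.translateHom σ : Equiv.Perm N) 1 = 1 ↔ σ ∈ L.fixingSubgroup := by
  rw [← α.orbitEquiv.injective.eq_iff, orbitEquiv_translateHom, orbitEquiv_apply, map_one]
  change ((σ * 1 : Gal(E/K)) : CosetSpace L) = ((1 : Gal(E/K)) : CosetSpace L) ↔ _
  rw [mul_one, eq_comm, QuotientGroup.eq]
  simp

/-- Byott's translation: the embedding `β : G → Hol N` corresponding to `α : N → Perm X`. It is
`β(σ) = a⁻¹ ∘ λ(σ) ∘ a`, where `a : N → X` is the bijection `a(η) = α(η)(e G_L)`. -/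
def byott [IsNormalClosure K L E] (α : RegularEmbedding L N) : HolEmbedding L N where
  toHom := α.translateHom
  injective σ τ h := lam_injective (L := L) <|
    α.orbitEquiv.symm.permCongrHom.injective (congrArg Subtype.val h)
  stabilizer b := by
    constructor
    · rintro ⟨σ, hσ, rfl⟩
      exact ⟨⟨σ, rfl⟩, (α.translateHom_apply_one σ).2 hσ⟩
    · rintro ⟨⟨σ, rfl⟩, h⟩
      exact ⟨σ, (α.translateHom_apply_one σ).1 h, rfl⟩

end RegularEmbedding

/-- The composition `β̄ : G → Aut N` of `β : G → Hol N = ρ(N) ⋊ Aut N` with the projection onto the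
automorphism component. -/
def HolEmbedding.autPart (β : HolEmbedding L N) : Gal(E/K) →* MulAut N :=
  (holProj N).comp β.toHom

end GreitherPareigis

end HopfGalois

end

noncomputable section

open scoped TensorProduct

namespace HopfGalois

/-! ### Equivariant isomorphisms of groups and isomorphisms of fixed Hopf algebras. -/

section ScalarExtension

universe u v

variable {K : Type*} {E : Type v} [Field K] [Field E] [Algebra K E]
  {M M₁ M₂ : Type u} [Group M] [Group M₁] [Group M₂]

variable {θ₁ : Gal(E/K) →* MulAut M₁} {θ₂ : Gal(E/K) →* MulAut M₂}

/-! The theorem is Galois descent combined with the rigidity of group-like elements. The fixed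
algebra `E[M]^G` is a `K`-form of `E[M]`: a `K`-basis of it is an `E`-basis of `E[M]`. Hence a
`K`-bialgebra map `E[M₁]^G → E[M₂]^G` extends uniquely to an `E`-bialgebra map `E[M₁] → E[M₂]`, and
the extension commutes with the semilinear actions of `G`. Since `E` is a field, the group-like
elements of `E[M]` are exactly the elements of `M`, so the extension comes from a `G`-equivariant
homomorphism `M₁ → M₂`. Conversely, an equivariant isomorphism of groups restricts to the fixed
algebras. This is `nonempty_fixedAlgebra_equiv_iff`. Bialgebra isomorphisms suffice throughout,
because they preserve antipodes automatically.

It remains to identify the `G`-group `α(N)`. By `RegularEmbedding.rangeEquiv_autPart`, conjugation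
by `λ(σ)` on `α(N)` is the action of `β̄(σ)` on `N`. An equivariant isomorphism `α₁(N) ≃ α₂(N)` is
therefore an automorphism `μ` of `N` intertwining `β̄₁` and `β̄₂`. When `Aut N` is abelian,
conjugation by `μ` is trivial. -/

theorem domCongr_galAction (e : M₁ ≃* M₂) (he : ∀ σ m, e (θ₁ σ m) = θ₂ σ (e m)) (σ : Gal(E/K))
    (x : MonoidAlgebra E M₁) : MonoidAlgebra.domCongr E E e (galAction θ₁ σ x) =
      galAction θ₂ σ (MonoidAlgebra.domCongr E E e x) := by
  induction x using MonoidAlgebra.induction_linear with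
  | zero => simp
  | add x y hx hy => simp only [map_add, hx, hy]
  | single m r => simp [galAction_single, he]

/-- The homomorphism of fixed algebras induced by an equivariant isomorphism of groups. -/
def fixedMap (e : M₁ ≃* M₂) (he : ∀ σ m, e (θ₁ σ m) = θ₂ σ (e m)) :
    fixedAlgebra θ₁ →ₐ[K] fixedAlgebra θ₂ :=
  (((MonoidAlgebra.domCongr E E e).toAlgHom.restrictScalars K).comp
    (fixedAlgebra θ₁).val).codRestrict _ fun x σ =>
      (domCongr_galAction e he σ x).symm.trans (congrArg _ (x.2 σ))

theorem coe_fixedMap (e : M₁ ≃* M₂) (he : ∀ σ m, e (θ₁ σ m) = θ₂ σ (e m)) (x : fixedAlgebra θ₁) :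
    (fixedMap e he x : MonoidAlgebra E M₂) = MonoidAlgebra.domCongr E E e x := rfl

/-! ### Galois descent: the fixed algebra is a `K`-form of the group algebra. -/

variable [FiniteDimensional K E] [IsGalois K E]

/-- Every `x` is an `E`-combination of traces. With dual families satisfying `∑ i, d i * σ (b i) =
δ_{σ,1}`, the sum of `d i` times the trace of `b i • x` keeps only the term `σ = 1`, which is `x`.
-/
theorem span_fixedAlgebra (θ : Gal(E/K) →* MulAut M) :
    Submodule.span E (fixedAlgebra θ : Set (MonoidAlgebra E M)) = ⊤ := by
  classical
  rw [eq_top_iff]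
  intro x _
  obtain ⟨b, d, hbd⟩ := exists_dual_families (K := K) (E := E)
  have h : x = ∑ i, d i • (orbitSum θ (b i • x) : MonoidAlgebra E M) := by
    simp only [coe_orbitSum, Finset.smul_sum, galAction_smul, smul_smul]
    rw [Finset.sum_comm]
    simp only [← Finset.sum_smul]
    have h1 : ∀ σ : Gal(E/K), ∑ i, d i * σ (b i) = if σ = 1 then 1 else 0 := fun σ => by
      simpa [mul_comm] using hbd σ 1
    simp [h1]
  rw [h]
  exact Submodule.sum_mem _ fun i _ =>
    Submodule.smul_mem _ _ (Submodule.subset_span (orbitSum θ (b i • x)).2)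

/-- A `K`-basis of `E[M]^G` is an `E`-basis of `E[M]`. -/
def fixedBasis (θ : Gal(E/K) →* MulAut M) {ι : Type (max u v)} (b : Module.Basis ι K (fixedAlgebra θ)) :
    Module.Basis ι E (MonoidAlgebra E M) :=
  Module.Basis.mk (v := fun i => (b i : MonoidAlgebra E M))
    ((isHopfForm_fixedAlgebra θ).linInd ι b b.linearIndependent) (by
      rw [← span_fixedAlgebra θ, Submodule.span_le]
      intro x hx
      have h := congrArg (fixedAlgebra θ).val (b.linearCombination_repr ⟨x, hx⟩)
      rw [Finsupp.linearCombination_apply, Finsupp.sum, map_sum] at h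
      change _ = x at h
      rw [← h]
      refine Submodule.sum_mem _ fun i _ => ?_
      rw [map_smul, ← algebraMap_smul E]
      exact Submodule.smul_mem _ _ (Submodule.subset_span ⟨i, rfl⟩))

theorem fixedBasis_apply (θ : Gal(E/K) →* MulAut M) {ι : Type (max u v)}
    (b : Module.Basis ι K (fixedAlgebra θ)) (i : ι) :
    fixedBasis θ b i = (b i : MonoidAlgebra E M) := by
  simp [fixedBasis]

/-- Additive maps out of `E[M]` that are semilinear are determined by their values on `E[M]^G`. -/
theorem eq_of_eqOn_fixedAlgebra {V : Type*} [AddCommGroup V] [Module E V] {σ : E →+* E}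
    (θ : Gal(E/K) →* MulAut M) {f g : MonoidAlgebra E M →ₛₗ[σ] V}
    (h : ∀ x : fixedAlgebra θ, f x = g x) : f = g :=
  LinearMap.ext_on (span_fixedAlgebra θ) fun x hx => h ⟨x, hx⟩

/-! ### Extension of scalars for linear maps and bialgebra homomorphisms. -/

/-- The `E`-linear extension of a `K`-linear map between fixed algebras. -/
def extendLinear (f : fixedAlgebra θ₁ →ₗ[K] fixedAlgebra θ₂) :
    MonoidAlgebra E M₁ →ₗ[E] MonoidAlgebra E M₂ :=
  (fixedBasis θ₁ (Module.Basis.ofVectorSpace K (fixedAlgebra θ₁))).constr E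
    fun i => f (Module.Basis.ofVectorSpace K (fixedAlgebra θ₁) i)

@[simp] theorem extendLinear_coe (f : fixedAlgebra θ₁ →ₗ[K] fixedAlgebra θ₂)
    (x : fixedAlgebra θ₁) : extendLinear f (x : MonoidAlgebra E M₁) = f x := by
  let b := Module.Basis.ofVectorSpace K (fixedAlgebra θ₁)
  have h : ((extendLinear f).restrictScalars K).comp (fixedAlgebra θ₁).val.toLinearMap =
      (fixedAlgebra θ₂).val.toLinearMap.comp f := by
    refine b.ext fun i => ?_
    change extendLinear f (b i : MonoidAlgebra E M₁) = f (b i)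
    rw [← fixedBasis_apply θ₁ b i]
    exact Module.Basis.constr_basis _ _ _ _
  exact LinearMap.congr_fun h x

/-- The extension of a homomorphism of `K`-bialgebras `E[M₁]^G → E[M₂]^G` to a homomorphism of
`E`-bialgebras `E[M₁] → E[M₂]`. -/
def extendBialgHom (f : fixedAlgebra θ₁ →ₐc[K] fixedAlgebra θ₂) :
    MonoidAlgebra E M₁ →ₐc[E] MonoidAlgebra E M₂ :=
  .ofAlgHom
    (AlgHom.ofLinearMap (extendLinear (f : fixedAlgebra θ₁ →ₗ[K] fixedAlgebra θ₂))
      (by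
        have h := extendLinear_coe (f : fixedAlgebra θ₁ →ₗ[K] fixedAlgebra θ₂) 1
        simpa using h)
      (by
        intro x y
        set F := extendLinear (f : fixedAlgebra θ₁ →ₗ[K] fixedAlgebra θ₂) with hF
        -- Multiplicativity spreads from the fixed algebra one factor at a time: here the left
        -- factor is fixed by `G` and the right one becomes arbitrary, then `h2` frees the left
        -- factor.
        have h1 : ∀ a : fixedAlgebra θ₁, F ∘ₗ LinearMap.mulLeft E (a : MonoidAlgebra E M₁) =
            LinearMap.mulLeft E (f a : MonoidAlgebra E M₂) ∘ₗ F := by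
          intro a
          refine eq_of_eqOn_fixedAlgebra θ₁ fun b => ?_
          have h := extendLinear_coe (f : fixedAlgebra θ₁ →ₗ[K] fixedAlgebra θ₂) (a * b)
          simpa [hF] using h
        have h2 : F ∘ₗ LinearMap.mulRight E y = LinearMap.mulRight E (F y) ∘ₗ F := by
          refine eq_of_eqOn_fixedAlgebra θ₁ fun a => ?_
          have h := LinearMap.congr_fun (h1 a) y
          simpa [hF] using h
        exact LinearMap.congr_fun h2 x))
    (by
      apply AlgHom.toLinearMap_injective
      refine eq_of_eqOn_fixedAlgebra θ₁ fun a => ?_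
      change Coalgebra.counit (R := E) (extendLinear (f : fixedAlgebra θ₁ →ₗ[K] fixedAlgebra θ₂) a)
        = Coalgebra.counit (R := E) (a : MonoidAlgebra E M₁)
      rw [extendLinear_coe, ← algebraMap_counit, ← algebraMap_counit]
      exact congrArg _ (CoalgHomClass.counit_comp_apply f a))
    (by
      apply AlgHom.toLinearMap_injective
      refine eq_of_eqOn_fixedAlgebra θ₁ fun a => ?_
      set F := extendLinear (f : fixedAlgebra θ₁ →ₗ[K] fixedAlgebra θ₂) with hF
      change TensorProduct.map F F (Coalgebra.comul (R := E) (a : MonoidAlgebra E M₁)) =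
        Coalgebra.comul (R := E) (F a)
      -- `tensorIncl` intertwines `f ⊗ f` over `K` with `F ⊗ F` over `E`, so compatibility of `f`
      -- with `Δ` passes to `F` on the fixed algebra, which spans.
      have h : ∀ t : fixedAlgebra θ₁ ⊗[K] fixedAlgebra θ₁,
          TensorProduct.map F F (tensorIncl (E := E) (fixedAlgebra θ₁) t) =
          tensorIncl (E := E) (fixedAlgebra θ₂)
            (TensorProduct.map (f : fixedAlgebra θ₁ →ₗ[K] fixedAlgebra θ₂)
              (f : fixedAlgebra θ₁ →ₗ[K] fixedAlgebra θ₂) t) := by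
        intro t
        induction t with
        | zero => simp
        | tmul x y => simp [hF]
        | add x y hx hy => simp only [map_add, hx, hy]
      rw [← tensorIncl_comul, h, hF, extendLinear_coe]
      refine Eq.trans ?_ (tensorIncl_comul θ₂ (f a))
      exact congrArg _ (CoalgHomClass.map_comp_comul_apply f a))

@[simp] theorem extendBialgHom_coe (f : fixedAlgebra θ₁ →ₐc[K] fixedAlgebra θ₂)
    (x : fixedAlgebra θ₁) : extendBialgHom f (x : MonoidAlgebra E M₁) = f x :=
  extendLinear_coe _ x

/-- Both sides are `σ`-semilinear in `x`, and on the spanning set `E[M₁]^G` both equal `f x`, which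
is itself fixed by `σ`. -/
theorem extendBialgHom_galAction (f : fixedAlgebra θ₁ →ₐc[K] fixedAlgebra θ₂) (σ : Gal(E/K))
    (x : MonoidAlgebra E M₁) :
    extendBialgHom f (galAction θ₁ σ x) = galAction θ₂ σ (extendBialgHom f x) := by
  have hx : x ∈ Submodule.span E (fixedAlgebra θ₁ : Set (MonoidAlgebra E M₁)) := by
    rw [span_fixedAlgebra]
    trivial
  induction hx using Submodule.span_induction with
  | mem x h =>
    rw [h σ, extendBialgHom_coe f ⟨x, h⟩]
    exact ((f ⟨x, h⟩).2 σ).symm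
  | zero => simp
  | add x y _ _ hx hy => simp only [map_add, hx, hy]
  | smul a x _ hx => simp only [galAction_smul, map_smul, hx]

/-! ### From bialgebra maps to group homomorphisms, through group-like elements. -/

/-- The group homomorphism induced on group-like elements after extension of scalars. -/
def groupLikeHom (f : fixedAlgebra θ₁ →ₐc[K] fixedAlgebra θ₂) : M₁ →* M₂ :=
  MonoidAlgebra.mapDomainOfBialgHom (extendBialgHom f)

theorem single_groupLikeHom (f : fixedAlgebra θ₁ →ₐc[K] fixedAlgebra θ₂) (m : M₁) (r : E) :
    MonoidAlgebra.single (groupLikeHom f m) r = extendBialgHom f (MonoidAlgebra.single m r) :=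
  MonoidAlgebra.single_mapDomainOfBialgHom _ _ _

/-- On an element of `M₁` with coefficient `1`, the semilinear action only moves the group element,
so equivariance of the extended map is equivariance on groups. -/
theorem groupLikeHom_equivariant (f : fixedAlgebra θ₁ →ₐc[K] fixedAlgebra θ₂) (σ : Gal(E/K))
    (m : M₁) : groupLikeHom f (θ₁ σ m) = θ₂ σ (groupLikeHom f m) := by
  refine MonoidAlgebra.single_left_injective (R := E) one_ne_zero ?_
  have h := extendBialgHom_galAction f σ (MonoidAlgebra.single m 1)
  rw [galAction_single, ← single_groupLikeHom, ← single_groupLikeHom, galAction_single,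
    map_one] at h
  exact h

/-- The composite of the two extensions is `E`-linear and is the identity on `E[M₁]^G`, hence
everywhere. Used in both directions, this makes the group homomorphism of an isomorphism invertible.
-/
theorem groupLikeHom_comp {f : fixedAlgebra θ₁ →ₐc[K] fixedAlgebra θ₂}
    {g : fixedAlgebra θ₂ →ₐc[K] fixedAlgebra θ₁} (h : ∀ x, g (f x) = x) :
    (groupLikeHom g).comp (groupLikeHom f) = MonoidHom.id M₁ := by
  refine MonoidHom.ext fun m => ?_
  rw [MonoidHom.comp_apply, MonoidHom.id_apply]
  refine MonoidAlgebra.single_left_injective (R := E) one_ne_zero ?_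
  change MonoidAlgebra.single _ _ = MonoidAlgebra.single _ _
  rw [single_groupLikeHom, single_groupLikeHom]
  have h1 : (extendLinear (g : fixedAlgebra θ₂ →ₗ[K] fixedAlgebra θ₁)) ∘ₗ
      (extendLinear (f : fixedAlgebra θ₁ →ₗ[K] fixedAlgebra θ₂)) = LinearMap.id :=
    eq_of_eqOn_fixedAlgebra θ₁ fun x => by simp [h]
  exact LinearMap.congr_fun h1 _

/-! ### From equivariant group isomorphisms back to Hopf algebras. -/

/-- The isomorphism of Hopf algebras induced by an equivariant isomorphism of groups. -/
def fixedEquiv (e : M₁ ≃* M₂) (he : ∀ σ m, e (θ₁ σ m) = θ₂ σ (e m)) :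
    fixedAlgebra θ₁ ≃ₐc[K] fixedAlgebra θ₂ :=
  have he' : ∀ σ m, e.symm (θ₂ σ m) = θ₁ σ (e.symm m) := fun σ m => by
    rw [MulEquiv.symm_apply_eq, he, MulEquiv.apply_symm_apply]
  .ofAlgEquiv
    (AlgEquiv.ofAlgHom (fixedMap e he) (fixedMap e.symm he')
      (AlgHom.ext fun x => Subtype.ext <|
        (MonoidAlgebra.domCongr E E e).apply_symm_apply (x : MonoidAlgebra E M₂))
      (AlgHom.ext fun x => Subtype.ext <|
        (MonoidAlgebra.domCongr E E e).symm_apply_apply (x : MonoidAlgebra E M₁)))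
    (AlgHom.ext fun x => (algebraMap K E).injective <| by
      change algebraMap K E (Coalgebra.counit (R := K) (fixedMap e he x)) =
        algebraMap K E (Coalgebra.counit (R := K) x)
      rw [algebraMap_counit, algebraMap_counit, coe_fixedMap, MonoidAlgebra.counit_domCongr])
    -- Injectivity of `tensorIncl` moves the identity into `E[M₂] ⊗[E] E[M₂]`, where it is the
    -- compatibility with `Δ` of the bialgebra isomorphism `E[M₁] ≃ E[M₂]` given by `e`.
    (AlgHom.ext fun x => (isHopfForm_fixedAlgebra θ₂).injective₂ <| by
      change tensorIncl (E := E) (fixedAlgebra θ₂) (TensorProduct.map (fixedMap e he).toLinearMap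
          (fixedMap e he).toLinearMap (Coalgebra.comul (R := K) x)) =
        tensorIncl (E := E) (fixedAlgebra θ₂) (Coalgebra.comul (R := K) (fixedMap e he x))
      let F : MonoidAlgebra E M₁ ≃ₐc[E] MonoidAlgebra E M₂ :=
        MonoidAlgebra.domCongrBialgEquiv E E e
      have h : ∀ t : fixedAlgebra θ₁ ⊗[K] fixedAlgebra θ₁,
          tensorIncl (E := E) (fixedAlgebra θ₂) (TensorProduct.map (fixedMap e he).toLinearMap
            (fixedMap e he).toLinearMap t) =
          TensorProduct.map (F : MonoidAlgebra E M₁ →ₗ[E] MonoidAlgebra E M₂)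
            (F : MonoidAlgebra E M₁ →ₗ[E] MonoidAlgebra E M₂)
            (tensorIncl (E := E) (fixedAlgebra θ₁) t) := by
        intro t
        induction t with
        | zero => simp
        | tmul x y => rfl
        | add x y hx hy => simp only [map_add, hx, hy]
      rw [h, tensorIncl_comul, tensorIncl_comul]
      exact CoalgHomClass.map_comp_comul_apply F (x : MonoidAlgebra E M₁))

/-- The Hopf algebras `E[M₁]^G` and `E[M₂]^G` are isomorphic if and only if the groups `M₁` and
`M₂` are `G`-equivariantly isomorphic. -/
theorem nonempty_fixedAlgebra_equiv_iff :
    Nonempty (fixedAlgebra θ₁ ≃ₐc[K] fixedAlgebra θ₂) ↔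
      ∃ e : M₁ ≃* M₂, ∀ σ m, e (θ₁ σ m) = θ₂ σ (e m) := by
  constructor
  · rintro ⟨f⟩
    let p : fixedAlgebra θ₁ →ₐc[K] fixedAlgebra θ₂ := f.toBialgHom
    let q : fixedAlgebra θ₂ →ₐc[K] fixedAlgebra θ₁ := f.symm.toBialgHom
    have hpq : ∀ x, q (p x) = x := f.toEquiv.left_inv
    have hqp : ∀ x, p (q x) = x := f.toEquiv.right_inv
    exact ⟨MonoidHom.toMulEquiv (groupLikeHom p) (groupLikeHom q)
      (groupLikeHom_comp hpq) (groupLikeHom_comp hqp), groupLikeHom_equivariant p⟩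
  · rintro ⟨e, he⟩
    exact ⟨fixedEquiv e he⟩

end ScalarExtension

/-! ### Byott's translation and the action of `G` on `α(N)`. -/

section Byott

variable {K E : Type*} [Field K] [Field E] [Algebra K E] [FiniteDimensional K E]
  {L : IntermediateField K E} {N : Type*} [Group N]

/-- The isomorphism of `N` with its image under a regular embedding. -/
def RegularEmbedding.rangeEquiv (α : RegularEmbedding L N) : N ≃* α.toHom.range :=
  MonoidHom.ofInjective α.injective

/-- The isomorphism `N ≃ α(N)` is equivariant for the action of `G` on `N` through `β̄`. -/
theorem RegularEmbedding.rangeEquiv_autPart [IsNormalClosure K L E] (α : RegularEmbedding L N)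
    (σ : Gal(E/K)) (n : N) :
    α.rangeEquiv (α.byott.autPart σ n) = α.conjAction σ (α.rangeEquiv n) := by
  apply Subtype.ext
  rw [coe_conjAction]
  change α.toHom ((α.translateHom σ : Equiv.Perm N) n *
    ((α.translateHom σ : Equiv.Perm N) 1)⁻¹) = lam L σ * α.toHom n * (lam L σ)⁻¹
  -- It suffices to compare `α(β̄(σ) n) λ(σ)` and `λ(σ) α(n)` at a point `a(y)`. Since `a` carries
  -- `β(σ)` to `λ(σ)` and left multiplication to `α`, the claim becomes the holomorph identity `f (n
  -- * y) = f n * (f 1)⁻¹ * f y` for `f = β(σ)`.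
  rw [eq_mul_inv_iff_mul_eq]
  refine Equiv.ext fun x => ?_
  obtain ⟨y, rfl⟩ := α.orbitEquiv.surjective x
  simp only [Equiv.Perm.mul_apply]
  rw [← orbitEquiv_mul, ← orbitEquiv_translateHom, ← orbitEquiv_translateHom, ← orbitEquiv_mul,
    apply_mul_of_mem_Hol (α.translateHom σ).2]

/-- Equivariant isomorphisms `e : α₁(N) ≃ α₂(N)` and intertwining automorphisms `μ` of `N` determine
each other by transport along the isomorphisms `N ≃ αᵢ(N)`. -/
theorem nonempty_hopfAlgebra_equiv_iff [IsGalois K E] [IsNormalClosure K L E]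
    (α₁ α₂ : RegularEmbedding L N) :
    Nonempty (α₁.hopfAlgebra ≃ₐc[K] α₂.hopfAlgebra) ↔
      ∃ μ : MulAut N, ∀ g : Gal(E/K), α₂.byott.autPart g = μ * α₁.byott.autPart g * μ⁻¹ := by
  rw [nonempty_fixedAlgebra_equiv_iff]
  constructor
  · rintro ⟨e, he⟩
    refine ⟨(α₁.rangeEquiv.trans e).trans α₂.rangeEquiv.symm, fun g => ?_⟩
    rw [eq_mul_inv_iff_mul_eq]
    refine MulEquiv.ext fun n => α₂.rangeEquiv.injective ?_
    simp only [MulAut.mul_apply, MulEquiv.trans_apply, RegularEmbedding.rangeEquiv_autPart,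
      MulEquiv.apply_symm_apply, he]
  · rintro ⟨μ, hμ⟩
    refine ⟨(α₁.rangeEquiv.symm.trans μ).trans α₂.rangeEquiv, fun g m => ?_⟩
    obtain ⟨n, rfl⟩ := α₁.rangeEquiv.surjective m
    -- Evaluating at `μ n` cancels `μ⁻¹` and leaves `β̄₂(g) (μ n) = μ (β̄₁(g) n)`.
    have h := congrArg (fun φ : MulAut N => φ (μ n)) (hμ g)
    simp only [MulAut.mul_apply, MulAut.inv_apply_self] at h
    simp only [← RegularEmbedding.rangeEquiv_autPart, MulEquiv.trans_apply,
      MulEquiv.symm_apply_apply, h]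

/-- Every endomorphism of a cyclic group is a power map `x ↦ x ^ k`, and power maps commute. -/
theorem mulAut_mul_comm_of_isCyclic [IsCyclic N] (φ ψ : MulAut N) : φ * ψ = ψ * φ := by
  obtain ⟨a, ha⟩ := MonoidHom.map_cyclic φ.toMonoidHom
  obtain ⟨b, hb⟩ := MonoidHom.map_cyclic ψ.toMonoidHom
  refine MulEquiv.ext fun n => ?_
  change φ.toMonoidHom (ψ.toMonoidHom n) = ψ.toMonoidHom (φ.toMonoidHom n)
  rw [ha, hb, hb, ha, zpow_comm]

end Byott

end HopfGalois

end

theorem mainTheorem3 {K E : Type*} [Field K] [Field E] [Algebra K E]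
    [FiniteDimensional K E] [IsGalois K E]
    (L : IntermediateField K E) [IsNormalClosure K L E]
    {N : Type*} [Group N] (α₁ α₂ : HopfGalois.RegularEmbedding L N) :
    (Nonempty (α₁.hopfAlgebra ≃ₐc[K] α₂.hopfAlgebra) ↔
      ∃ μ : MulAut N, ∀ g : Gal(E/K),
        α₂.byott.autPart g = μ * α₁.byott.autPart g * μ⁻¹) ∧
    ((∀ φ ψ : MulAut N, φ * ψ = ψ * φ) →
      (Nonempty (α₁.hopfAlgebra ≃ₐc[K] α₂.hopfAlgebra) ↔
        ∀ g : Gal(E/K), α₁.byott.autPart g = α₂.byott.autPart g)) ∧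
    (IsCyclic N →
      (Nonempty (α₁.hopfAlgebra ≃ₐc[K] α₂.hopfAlgebra) ↔
        ∀ g : Gal(E/K), α₁.byott.autPart g = α₂.byott.autPart g)) := by
  have h : (∀ φ ψ : MulAut N, φ * ψ = ψ * φ) →
      (Nonempty (α₁.hopfAlgebra ≃ₐc[K] α₂.hopfAlgebra) ↔
        ∀ g : Gal(E/K), α₁.byott.autPart g = α₂.byott.autPart g) := by
    intro hc
    rw [HopfGalois.nonempty_hopfAlgebra_equiv_iff]
    constructor
    · rintro ⟨μ, hμ⟩ g
      -- Commuting `μ` past `β̄₁(g)` makes the conjugation trivial; in the converse direction `μ =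
      -- 1` serves.
      rw [hμ g, hc μ, mul_inv_cancel_right]
    · exact fun hg => ⟨1, fun g => by simp [hg g]⟩
  exact ⟨HopfGalois.nonempty_hopfAlgebra_equiv_iff α₁ α₂, h,
    fun _ => h HopfGalois.mulAut_mul_comm_of_isCyclic⟩
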